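/- Let $k$ be a field of characteristic zero and $\bar k$ an algebraic closure of $k$. Let $X$, $Y$ be connected, separated, normal schemes of finite type over $k$, let $t: Y\to \mathrm{Spec}(k)$ be the structure morphism, and let $f: X\to Y$ be a smooth $k$-morphism. Write $\Pi_X$, $\Pi_Y$ for the étale fundamental groups of $X$, $Y$ (with respect to chosen geometric base points), and fix representatives $f_*:\Pi_X\to\Pi_Y$ and $t_*:\Pi_Y\to\mathrm{Gal}(\bar k/k)$ of the induced outer homomorphisms. Assume that $f_*$ and $t_*$ are surjective. Let $s:\mathrm{Gal}(\bar k/k)\to\Pi_Y$ be a continuous section of $t_*$, i.e. a continuous homomorphism with $t_*\circ s=\mathrm{id}$. The collection $\mathcal C=(X,Y,f,k,\bar k,t,s)$ is called a virtual variety. Its virtual fundamental group is the fibre product $$\Pi_{\mathcal C}=\Pi_X\times_{\Pi_Y}\mathrm{Gal}(\bar k/k)=\{(a,\sigma): f_*(a)=s(\sigma)\}\subseteq \Pi_X\times\mathrm{Gal}(\bar k/k),$$ and its geometric virtual fundamental group $\Delta_{\mathcal C}$ is the kernel of the projection $\Pi_{\mathcal C}\to\mathrm{Gal}(\bar k/k)$.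 Then the inclusion $\Delta_{\mathcal C}\to\Pi_{\mathcal C}$, the projection $\Pi_{\mathcal C}\to\mathrm{Gal}(\bar k/k)$, the composite $\Delta_{\mathcal C}\to\Pi_{\mathcal C}\to\Pi_X$ and $f_*$ form exact sequences of profinite groups $$1\to\Delta_{\mathcal C}\to\Pi_{\mathcal C}\to\mathrm{Gal}(\bar k/k)\to 1,$$ $$1\to\Delta_{\mathcal C}\to\Pi_X\xrightarrow{f_*}\Pi_Y\to 1.$$ Moreover, $\Delta_{\mathcal C}$, considered as a subgroup of $\Pi_X$ via the second sequence, is independent of the choice of $s$: for fixed $(X,Y,f,k,\bar k,t)$ and fixed base point of $X$, any two sections (and any choices of the base point of $Y$ and of representatives $f_*$, $t_*$) give the same subgroup of $\Pi_X$. -/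

import Mathlib

open CategoryTheory AlgebraicGeometry

universe u

noncomputable section

namespace EtaleFundamental

/-- The class of finite étale morphisms of schemes. -/
abbrev finiteEtale : MorphismProperty Scheme.{u} := @IsFinite ⊓ @Etale

/-- The category of finite étale schemes over `X`, with all morphisms of `X`-schemes. -/
abbrev FEt (X : Scheme.{u}) : Type (u + 1) := finiteEtale.{u}.Over ⊤ X

instance (X : Scheme.{u}) (Z : FEt X) : IsFinite Z.hom := Z.prop.1

instance (X : Scheme.{u}) (Z : FEt X) : Etale Z.hom := Z.prop.2

/-- A geometric point of `X`: a morphism to `X` from the spectrum of an algebraically closed field. -/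
structure GeometricPoint (X : Scheme.{u}) where
  Ω : Type u
  [field : Field Ω]
  [isAlgClosed : IsAlgClosed Ω]
  pt : Spec (.of Ω) ⟶ X

attribute [instance] GeometricPoint.field GeometricPoint.isAlgClosed

namespace GeometricPoint

/-- The image `f ∘ x` of a geometric point `x` of `X` under `f : X ⟶ Y`. -/
@[simps! Ω pt]
def map {X Y : Scheme.{u}} (x : GeometricPoint X) (f : X ⟶ Y) : GeometricPoint Y where
  Ω := x.Ω
  pt := x.pt ≫ f

/-- The geometric fibre of `Z` over `x`: the set of `X`-morphisms from the geometric point `x` to `Z`. -/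
@[ext]
structure Fiber {X : Scheme.{u}} (x : GeometricPoint X) (Z : FEt X) : Type u where
  pt : Spec (.of x.Ω) ⟶ Z.left
  w : pt ≫ Z.hom = x.pt

instance {X : Scheme.{u}} (x : GeometricPoint X) (Z : FEt X) : Finite (x.Fiber Z) := by
  let P := Limits.pullback Z.hom x.pt
  let q : P ⟶ Spec (.of x.Ω) := Limits.pullback.snd Z.hom x.pt
  have hq : IsFinite q := by dsimp only [q]; infer_instance
  have hP : IsAffine P := isAffine_of_isAffineHom q
  let r : x.Ω →+* Γ(P, ⊤) :=
    (q.appTop.hom).comp (Scheme.ΓSpecIso (.of x.Ω)).inv.hom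
  have hr : r.Finite := by
    have h1 : q.appTop.hom.Finite := q.finite_appTop
    exact h1.comp (RingHom.Finite.of_surjective _
      (Scheme.ΓSpecIso (.of x.Ω)).symm.commRingCatIsoToRingEquiv.surjective)
  algebraize [r]
  let F : x.Fiber Z → (Γ(P, ⊤) →ₐ[x.Ω] x.Ω) := fun z =>
    let l : Spec (.of x.Ω) ⟶ P :=
      Limits.pullback.lift z.pt (𝟙 _) (by rw [z.w]; exact (Category.id_comp _).symm)
    { (Scheme.ΓSpecIso (.of x.Ω)).hom.hom.comp l.appTop.hom with
      commutes' := by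
        intro a
        have h : l ≫ q = 𝟙 _ := Limits.pullback.lift_snd _ _ _
        have h2 : q.appTop ≫ l.appTop = 𝟙 _ := by
          rw [← Scheme.Hom.comp_appTop, h]; rfl
        have h3 : (Scheme.ΓSpecIso (.of x.Ω)).inv ≫ q.appTop ≫ l.appTop ≫
          (Scheme.ΓSpecIso (.of x.Ω)).hom = 𝟙 _ := by
          rw [reassoc_of% h2]; simp
        exact congrArg (fun g => g.hom a) h3 }
  refine Finite.of_injective F ?_
  intro z w h
  have h0 := congrArg (fun g : (Γ(P, ⊤) →ₐ[x.Ω] x.Ω) => CommRingCat.ofHom g.toRingHom) h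
  let lz : Spec (.of x.Ω) ⟶ P :=
      Limits.pullback.lift z.pt (𝟙 _) (by rw [z.w]; exact (Category.id_comp _).symm)
  let lw : Spec (.of x.Ω) ⟶ P :=
      Limits.pullback.lift w.pt (𝟙 _) (by rw [w.w]; exact (Category.id_comp _).symm)
  have h1 : lz.appTop ≫ (Scheme.ΓSpecIso (.of x.Ω)).hom
      = lw.appTop ≫ (Scheme.ΓSpecIso (.of x.Ω)).hom := h0
  have h2 : lz.appTop = lw.appTop := (cancel_mono _).1 h1
  have h3 : lz = lw := ext_of_isAffine h2
  apply Fiber.ext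
  have hz : lz ≫ Limits.pullback.fst Z.hom x.pt = z.pt := Limits.pullback.lift_fst _ _ _
  have hw : lw ≫ Limits.pullback.fst Z.hom x.pt = w.pt := Limits.pullback.lift_fst _ _ _
  rw [← hz, ← hw, h3]

/-- The fibre functor of the geometric point `x` on finite étale `X`-schemes. -/
def fiberFunctor {X : Scheme.{u}} (x : GeometricPoint X) : FEt X ⥤ FintypeCat.{u} where
  obj Z := FintypeCat.of (x.Fiber Z)
  map {Z W} g := FintypeCat.homMk fun z =>
    ⟨z.pt ≫ g.left, by rw [Category.assoc, MorphismProperty.Over.w g, z.w]⟩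
  map_id Z := by
    ext z
    exact Category.comp_id z.pt
  map_comp g h := by
    ext z
    exact (Category.assoc z.pt g.left h.left).symm

end GeometricPoint

/-- The étale fundamental group `π₁(X, x)`: the automorphism group of the fibre functor at `x`, with
its profinite topology (the topology that Mathlib puts on `Aut F` for a functor `F` to finite sets). -/
abbrev FundamentalGroup {X : Scheme.{u}} (x : GeometricPoint X) : Type (u + 1) :=
  Aut x.fiberFunctor

/-- An étale path from `x` to `x'`: an isomorphism of fibre functors. -/
abbrev Path {X : Scheme.{u}} (x x' : GeometricPoint X) : Type (u + 1) :=
  x.fiberFunctor ≅ x'.fiberFunctor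


open scoped PreGaloisCategory

lemma continuous_of_app {C G : Type*} [Category* C] [TopologicalSpace G] {F : C ⥤ FintypeCat.{u}}
    (φ : G → Aut F) (h : ∀ Z : C, Continuous fun g => (show Aut (F.obj Z) from (φ g).app Z)) :
    Continuous φ := by
  rw [(PreGaloisCategory.autEmbedding_isClosedEmbedding F).isInducing.continuous_iff,
    continuous_pi_iff]
  exact h

lemma continuous_app {C : Type*} [Category* C] (F : C ⥤ FintypeCat.{u}) (Z : C) :
    Continuous fun σ : Aut F => (show Aut (F.obj Z) from σ.app Z) :=
  (continuous_apply Z).comp (PreGaloisCategory.autEmbedding_isClosedEmbedding F).continuous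

/-- Conjugation by an isomorphism of functors, as a continuous homomorphism. -/
def autConj {C : Type*} [Category* C] {F F' : C ⥤ FintypeCat.{u}} (γ : F ≅ F') :
    Aut F →ₜ* Aut F' where
  toMonoidHom := γ.conjAut.toMonoidHom
  continuous_toFun := continuous_of_app _ fun Z => by
    have : (fun σ : Aut F => (show Aut (F'.obj Z) from (γ.conjAut σ).app Z)) =
        (fun τ : Aut (F.obj Z) => (γ.app Z).conjAut τ) ∘ fun σ : Aut F => (show Aut (F.obj Z) from σ.app Z) := by
      ext1 σ
      apply Iso.ext
      rw [Iso.conjAut_apply, Function.comp_apply, Iso.conjAut_apply]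
      rfl
    exact this ▸ continuous_of_discreteTopology.comp (continuous_app F Z)

/-- Precomposition with a functor `P`, as a continuous homomorphism `Aut F → Aut (P ⋙ F)`. -/
def autWhisker {C D : Type*} [Category* C] [Category* D] (P : C ⥤ D) (F : D ⥤ FintypeCat.{u}) :
    Aut F →ₜ* Aut (P ⋙ F) where
  toMonoidHom := ((Functor.whiskeringLeft _ _ _).obj P).mapAut F
  continuous_toFun := continuous_of_app _ fun Z => continuous_app F (P.obj Z)

/-- The isomorphism `π₁(X, x) → π₁(X, x')` defined by a path: change of base point. -/
def transport {X : Scheme.{u}} {x x' : GeometricPoint X} (γ : Path x x') :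
    FundamentalGroup x →ₜ* FundamentalGroup x' :=
  autConj γ

instance : finiteEtale.{u}.IsStableUnderBaseChange :=
  MorphismProperty.IsStableUnderBaseChange.inf

/-- Base change of finite étale covers along `f : X ⟶ Y`. -/
def pullbackFEt {X Y : Scheme.{u}} (f : X ⟶ Y) : FEt Y ⥤ FEt X :=
  MorphismProperty.Over.pullback finiteEtale ⊤ f

/-- The fibre of `Z ×_Y X` over `x` is the fibre of `Z` over `f ∘ x`. -/
def fiberPullbackEquiv {X Y : Scheme.{u}} (f : X ⟶ Y) (x : GeometricPoint X) (Z : FEt Y) :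
    x.Fiber ((pullbackFEt f).obj Z) ≃ (x.map f).Fiber Z where
  toFun z := ⟨z.pt ≫ Limits.pullback.fst Z.hom f, by
    have h : z.pt ≫ Limits.pullback.snd Z.hom f = x.pt := z.w
    exact (Category.assoc _ _ _).trans ((congrArg _ Limits.pullback.condition).trans
      ((Category.assoc _ _ _).symm.trans (congrArg (· ≫ f) h)))⟩
  invFun z := ⟨Limits.pullback.lift z.pt x.pt z.w, Limits.pullback.lift_snd _ _ _⟩
  left_inv z := by
    have h : z.pt ≫ Limits.pullback.snd Z.hom f = x.pt := z.w
    apply GeometricPoint.Fiber.ext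
    apply Limits.pullback.hom_ext
    · exact Limits.pullback.lift_fst _ _ _
    · exact (Limits.pullback.lift_snd _ _ _).trans h.symm
  right_inv z := GeometricPoint.Fiber.ext (Limits.pullback.lift_fst _ _ _)

/-- `fiberPullbackEquiv`, naturally in `Z`. -/
def fiberPullbackIso {X Y : Scheme.{u}} (f : X ⟶ Y) (x : GeometricPoint X) :
    pullbackFEt f ⋙ x.fiberFunctor ≅ (x.map f).fiberFunctor :=
  NatIso.ofComponents (fun Z => FintypeCat.equivEquivIso (fiberPullbackEquiv f x Z)) (by
    intro Z W g
    ext z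
    apply GeometricPoint.Fiber.ext
    have h : ((pullbackFEt f).map g).left ≫ Limits.pullback.fst W.hom f
        = Limits.pullback.fst Z.hom f ≫ g.left := Limits.pullback.lift_fst _ _ _
    have hz (z : x.Fiber ((pullbackFEt f).obj Z)) :
        (z.pt ≫ ((pullbackFEt f).map g).left) ≫ Limits.pullback.fst W.hom f
        = (z.pt ≫ Limits.pullback.fst Z.hom f) ≫ g.left :=
      (Category.assoc _ _ _).trans ((congrArg _ h).trans (Category.assoc _ _ _).symm)
    exact hz z)

/-- The homomorphism `f_* : π₁(X, x) → π₁(Y, f ∘ x)` induced by `f : X ⟶ Y`. -/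
def pushforward {X Y : Scheme.{u}} (f : X ⟶ Y) (x : GeometricPoint X) :
    FundamentalGroup x →ₜ* FundamentalGroup (x.map f) :=
  (autConj (fiberPullbackIso f x)).comp (autWhisker (pullbackFEt f) x.fiberFunctor)


section Galois

variable {k K : Type u} [Field k] [Field K] [Algebra k K]

/-- The automorphism `Spec σ` of the scheme `Spec K` defined by `σ ∈ Gal(K/k)`. -/
def specAut (σ : Gal(K/k)) : Spec (.of K) ⟶ Spec (.of K) :=
  Spec.map (CommRingCat.ofHom (σ : K →+* K))

lemma specAut_one : specAut (1 : Gal(K/k)) = 𝟙 _ := Spec.map_id _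

lemma specAut_mul (σ τ : Gal(K/k)) : specAut (σ * τ) = specAut σ ≫ specAut τ := by
  rw [specAut, specAut, specAut, ← Spec.map_comp]
  rfl

lemma specAut_w (σ : Gal(K/k)) :
    specAut σ ≫ Spec.map (CommRingCat.ofHom (algebraMap k K)) =
      Spec.map (CommRingCat.ofHom (algebraMap k K)) := by
  rw [specAut, ← Spec.map_comp]
  congr 1
  ext a
  exact σ.commutes a

variable [IsAlgClosure k K]

variable (k K) in
/-- The geometric point `Spec K ⟶ Spec k` given by an algebraic closure `K` of the field `k`. -/
abbrev fieldPoint : GeometricPoint (Spec (.of k)) where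
  Ω := K
  isAlgClosed := IsAlgClosure.isAlgClosed k
  pt := Spec.map (CommRingCat.ofHom (algebraMap k K))

/-- The left action of `σ ∈ Gal(K/k)` on `K`-valued points: on affine covers `Spec A` it sends
`φ : A → K` to `σ ∘ φ`. -/
def galoisAct (σ : Gal(K/k)) {Z : FEt (Spec (.of k))} (z : (fieldPoint k K).Fiber Z) :
    (fieldPoint k K).Fiber Z where
  pt := specAut σ ≫ z.pt
  w := (Category.assoc _ _ _).trans ((congrArg _ z.w).trans (specAut_w σ))

lemma galoisAct_one {Z : FEt (Spec (.of k))} (z : (fieldPoint k K).Fiber Z) :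
    galoisAct 1 z = z :=
  GeometricPoint.Fiber.ext ((congrArg (· ≫ z.pt) specAut_one).trans (Category.id_comp _))

lemma galoisAct_mul (σ τ : Gal(K/k)) {Z : FEt (Spec (.of k))} (z : (fieldPoint k K).Fiber Z) :
    galoisAct (σ * τ) z = galoisAct σ (galoisAct τ z) :=
  GeometricPoint.Fiber.ext
    ((congrArg (· ≫ z.pt) (specAut_mul σ τ)).trans (Category.assoc _ _ _))

/-- `galoisAct` as a permutation of the fibre. -/
def galoisActEquiv (σ : Gal(K/k)) (Z : FEt (Spec (.of k))) :
    (fieldPoint k K).Fiber Z ≃ (fieldPoint k K).Fiber Z where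
  toFun := galoisAct σ
  invFun := galoisAct σ⁻¹
  left_inv z := by rw [← galoisAct_mul, inv_mul_cancel, galoisAct_one]
  right_inv z := by rw [← galoisAct_mul, mul_inv_cancel, galoisAct_one]

variable (k K) in
/-- The natural homomorphism from `Gal(K/k)` to the fundamental group of `Spec k`. -/
def galoisToAut : Gal(K/k) →* FundamentalGroup (fieldPoint k K) where
  toFun σ := NatIso.ofComponents
    (fun Z => FintypeCat.equivEquivIso (galoisActEquiv σ Z)) (by
      intro Z W g
      ext z
      exact GeometricPoint.Fiber.ext
        (Category.assoc (specAut σ) (GeometricPoint.Fiber.pt z) g.left).symm)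
  map_one' := by
    apply Iso.ext
    ext Z z
    exact galoisAct_one z
  map_mul' σ τ := by
    apply Iso.ext
    ext Z z
    exact galoisAct_mul σ τ z

/-- The action of an element of the fundamental group on a fibre. -/
def act {X : Scheme.{u}} {x : GeometricPoint X} (α : FundamentalGroup x) {Z : FEt X}
    (z : x.Fiber Z) : x.Fiber Z := α.hom.app Z z

/-- The map on fibres induced by a morphism of finite étale covers. -/
def mapFiber {X : Scheme.{u}} {x : GeometricPoint X} {Z W : FEt X} (g : Z ⟶ W) (z : x.Fiber Z) :
   x.Fiber W := x.fiberFunctor.map g z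

lemma act_map {X : Scheme.{u}} {x : GeometricPoint X} (α : FundamentalGroup x) {Z W : FEt X}
    (g : Z ⟶ W) (z : x.Fiber Z) : act α (mapFiber g z) = mapFiber g (act α z) :=
  NatTrans.naturality_apply α.hom g z

lemma act_ext {X : Scheme.{u}} {x : GeometricPoint X} {α β : FundamentalGroup x}
    (h : ∀ (Z : FEt X) (z : x.Fiber Z), act α z = act β z) : α = β := by
  apply Iso.ext
  ext Z z
  exact h Z z

lemma act_galoisToAut (σ : Gal(K/k)) {Z : FEt (Spec (.of k))} (z : (fieldPoint k K).Fiber Z) :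
    act (galoisToAut k K σ) z = galoisAct σ z := rfl

variable [CharZero k]

/-- The finite étale cover `Spec E` of `Spec k` for a finite subextension `E` of `K/k`. -/
def extCover (E : IntermediateField k K) [FiniteDimensional k E] : FEt (Spec (.of k)) :=
  MorphismProperty.Over.mk ⊤ (Spec.map (CommRingCat.ofHom (algebraMap k E))) (by
    constructor
    · rw [IsFinite.SpecMap_iff]
      exact RingHom.finite_algebraMap.mpr inferInstance
    · rw [HasRingHomProperty.Spec_iff (P := @Etale)]
      have : Algebra.FormallyEtale k E := Algebra.FormallyEtale.of_isSeparable k E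
      have : Algebra.FinitePresentation k E :=
        Algebra.FinitePresentation.of_finiteType.mp inferInstance
      exact RingHom.etale_algebraMap.mpr {})

/-- The geometric point of `Spec E` given by the inclusion `E ⊆ K`. -/
def extPoint (E : IntermediateField k K) [FiniteDimensional k E] :
    (fieldPoint k K).Fiber (extCover E) where
  pt := Spec.map (CommRingCat.ofHom (algebraMap E K))
  w := (Spec.map_comp _ _).symm

lemma exists_algHom (E : IntermediateField k K) [FiniteDimensional k E]
    (z : (fieldPoint k K).Fiber (extCover E)) :
    ∃ φ : E →ₐ[k] K, z.pt = Spec.map (CommRingCat.ofHom φ.toRingHom) := by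
  obtain ⟨g, hg⟩ := Spec.map_surjective (R := .of E) (S := .of K) z.pt
  have hw : z.pt ≫ Spec.map (CommRingCat.ofHom (algebraMap k E)) = 
    Spec.map (CommRingCat.ofHom (algebraMap k K)) := z.w
  rw [← hg] at hw
  have h2 := Spec.map_injective ((Spec.map_comp _ _).trans hw)
  exact ⟨{ g.hom with commutes' := fun a => congrArg (fun q => q.hom a) h2 }, hg.symm⟩

lemma exists_factor (Z : FEt (Spec (.of k))) (z : (fieldPoint k K).Fiber Z) :
    ∃ (E : IntermediateField k K) (_ : FiniteDimensional k E) (g : extCover E ⟶ Z),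
      mapFiber g (extPoint E) = z := by
  let p : Z.left ⟶ Spec (.of k) := Z.hom
  have hp : IsFinite p := Z.prop.1
  have hZ : IsAffine Z.left := isAffine_of_isAffineHom p
  let r : k →+* Γ(Z.left, ⊤) :=
    (p.appTop.hom).comp (Scheme.ΓSpecIso (.of k)).inv.hom
  have hr : r.Finite :=
    (p.finite_appTop).comp (RingHom.Finite.of_surjective _
      (Scheme.ΓSpecIso (.of k)).symm.commRingCatIsoToRingEquiv.surjective)
  algebraize [r]
  let q : Spec (.of K) ⟶ Z.left := z.pt
  have hq : q ≫ p = Spec.map (CommRingCat.ofHom (algebraMap k K)) := z.w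
  let φ' : Γ(Z.left, ⊤) ⟶ .of K := q.appTop ≫ (Scheme.ΓSpecIso (.of K)).hom
  have hφ' : q = Spec.map φ' ≫ Z.left.isoSpec.inv := by
    rw [Iso.eq_comp_inv, ← Scheme.isoSpec_hom_naturality, Scheme.isoSpec_Spec_hom, ← Spec.map_comp]
  let φ : Γ(Z.left, ⊤) →ₐ[k] K :=
    { φ'.hom with
      commutes' := by
        intro a
        have h3 : (Scheme.ΓSpecIso (.of k)).inv ≫ p.appTop ≫ q.appTop ≫
          (Scheme.ΓSpecIso (.of K)).hom = CommRingCat.ofHom (algebraMap k K) := by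
          rw [← Category.assoc p.appTop, ← Scheme.Hom.comp_appTop, hq, Iso.inv_comp_eq]
          exact Scheme.ΓSpecIso_naturality _
        exact congrArg (fun g => g.hom a) h3 }
  have hfin : FiniteDimensional k φ.range :=
    Module.Finite.of_surjective φ.rangeRestrict.toLinearMap φ.rangeRestrict_surjective
  have : Algebra.IsAlgebraic k K := IsAlgClosure.isAlgebraic
  let E : IntermediateField k K := φ.range.toIntermediateField (fun x hx =>
    Subalgebra.inv_mem_of_algebraic (A := φ.range) (x := ⟨x, hx⟩)
      (Algebra.IsAlgebraic.isAlgebraic x))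
  have hE : FiniteDimensional k E := hfin
  let ψ : Γ(Z.left, ⊤) ⟶ .of E := CommRingCat.ofHom φ.rangeRestrict.toRingHom
  let i : CommRingCat.of E ⟶ .of K := CommRingCat.ofHom (algebraMap E K)
  have hψ : ψ ≫ i = φ' := rfl
  let g : Spec (.of E) ⟶ Z.left := Spec.map ψ ≫ Z.left.isoSpec.inv
  have hg : Spec.map i ≫ g = q := by
    rw [hφ', ← hψ, Spec.map_comp, Category.assoc]
  have hgw : g ≫ p = Spec.map (CommRingCat.ofHom (algebraMap k E)) := by
    obtain ⟨h, hh⟩ := Spec.map_surjective (R := .of k) (S := .of E) (g ≫ p)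
    have h1 : Spec.map (h ≫ i) = Spec.map (CommRingCat.ofHom (algebraMap k K)) := by
      rw [Spec.map_comp, hh, reassoc_of% hg, hq]
    have h2 := Spec.map_injective h1
    rw [← hh]
    congr 1
    ext a
    have h3 : ((h.hom a : E) : K) = algebraMap k K a := congrArg (fun g => g.hom a) h2
    exact congrArg (fun y : K => y) h3
  exact ⟨E, hE, MorphismProperty.Over.homMk g hgw, GeometricPoint.Fiber.ext hg⟩

lemma galoisToAut_injective : Function.Injective (galoisToAut k K) := by
  intro σ τ h
  ext x
  have : Algebra.IsAlgebraic k K := IsAlgClosure.isAlgebraic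
  let E : IntermediateField k K := IntermediateField.adjoin k {x}
  have hE : FiniteDimensional k E :=
    IntermediateField.adjoin.finiteDimensional (Algebra.IsIntegral.isIntegral x)
  have h1 : (galoisAct σ (extPoint E)).pt = (galoisAct τ (extPoint E)).pt := by
    rw [← act_galoisToAut, ← act_galoisToAut, h]
  have h2 := Spec.map_injective
    ((Spec.map_comp _ _).trans (h1.trans (Spec.map_comp _ _).symm))
  exact congrArg (fun g => g.hom ⟨x, IntermediateField.mem_adjoin_simple_self k x⟩) h2

lemma galoisToAut_surjective : Function.Surjective (galoisToAut k K) := by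
  intro α
  have : Algebra.IsAlgebraic k K := IsAlgClosure.isAlgebraic
  choose φ hφ using fun (E : IntermediateField k K) (_ : FiniteDimensional k E) =>
    exists_algHom E (act α (extPoint E))
  have key (E E' : IntermediateField k K) (hE : FiniteDimensional k E)
      (hE' : FiniteDimensional k E') (hle : E ≤ E') (x : K) (hx : x ∈ E) :
      φ E hE ⟨x, hx⟩ = φ E' hE' ⟨x, hle hx⟩ := by
    let j : CommRingCat.of E ⟶ .of E' :=
      CommRingCat.ofHom (IntermediateField.inclusion hle).toRingHom
    let g : extCover E' ⟶ extCover E := MorphismProperty.Over.homMk (Spec.map j)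
      (Spec.map_comp _ _).symm
    have h1 : mapFiber g (extPoint E') = extPoint E :=
      GeometricPoint.Fiber.ext (Spec.map_comp _ _).symm
    have h2 : act α (extPoint E) = mapFiber g (act α (extPoint E')) := by
      rw [← h1, act_map]
    have h3 : (act α (extPoint E)).pt = (act α (extPoint E')).pt ≫ Spec.map j :=
      congrArg GeometricPoint.Fiber.pt h2
    have h4 : Spec.map (CommRingCat.ofHom (φ E hE).toRingHom)
        = Spec.map (CommRingCat.ofHom (φ E' hE').toRingHom) ≫ Spec.map j :=
      (hφ E hE).symm.trans (h3.trans (congrArg (· ≫ Spec.map j) (hφ E' hE')))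
    have h5 := Spec.map_injective (h4.trans (Spec.map_comp _ _).symm)
    exact congrArg (fun g => g.hom ⟨x, hx⟩) h5
  have hfin (S : Set K) (hS : S.Finite) : FiniteDimensional k (IntermediateField.adjoin k S) :=
    have := hS.to_subtype
    IntermediateField.finiteDimensional_adjoin fun x _ => Algebra.IsIntegral.isIntegral x
  let s : K → K := fun x => φ (IntermediateField.adjoin k {x}) (hfin _ (Set.finite_singleton x))
    ⟨x, IntermediateField.mem_adjoin_simple_self k x⟩
  have hs (E : IntermediateField k K) (hE : FiniteDimensional k E) (x : K) (hx : x ∈ E) :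
      s x = φ E hE ⟨x, hx⟩ :=
    key _ E _ hE (IntermediateField.adjoin_simple_le_iff.2 hx) x _
  have hpair (x y : K) : ∃ (E : IntermediateField k K) (_ : FiniteDimensional k E),
      x ∈ E ∧ y ∈ E :=
    ⟨IntermediateField.adjoin k {x, y}, hfin _ (Set.toFinite _),
      IntermediateField.subset_adjoin _ _ (by simp), IntermediateField.subset_adjoin _ _ (by simp)⟩
  have hcomm (a : k) : s (algebraMap k K a) = algebraMap k K a := by
    rw [hs ⊥ inferInstance _ (IntermediateField.algebraMap_mem _ a)]
    exact (φ ⊥ inferInstance).commutes a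
  let σ₀ : K →ₐ[k] K :=
    { toFun := s
      map_one' := by simpa using hcomm 1
      map_zero' := by simpa using hcomm 0
      map_mul' := fun x y => by
        obtain ⟨E, hE, hx, hy⟩ := hpair x y
        rw [hs E hE x hx, hs E hE y hy, hs E hE _ (E.mul_mem hx hy), ← map_mul]
        rfl
      map_add' := fun x y => by
        obtain ⟨E, hE, hx, hy⟩ := hpair x y
        rw [hs E hE x hx, hs E hE y hy, hs E hE _ (E.add_mem hx hy), ← map_add]
        rfl
      commutes' := hcomm }
  let σ : Gal(K/k) := AlgEquiv.ofBijective σ₀ (Algebra.IsAlgebraic.algHom_bijective σ₀)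
  refine ⟨σ, act_ext fun Z z => ?_⟩
  obtain ⟨E, hE, g, rfl⟩ := exists_factor Z z
  rw [act_map, act_map]
  congr 1
  apply GeometricPoint.Fiber.ext
  rw [hφ E hE]
  refine (Spec.map_comp _ _).symm.trans (congrArg Spec.map ?_)
  ext x
  exact hs E hE x x.2

lemma continuous_galoisToAut_symm : Continuous (MulEquiv.ofBijective (galoisToAut k K)
    ⟨galoisToAut_injective, galoisToAut_surjective⟩).symm := by
  set e := MulEquiv.ofBijective (galoisToAut k K) ⟨galoisToAut_injective, galoisToAut_surjective⟩
  refine continuous_of_continuousAt_one e.symm ?_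
  rw [ContinuousAt, map_one]
  intro U hU
  obtain ⟨E, hE, hEU⟩ := (krullTopology_mem_nhds_one_iff k K U).1 hU
  have h1 : IsOpen {α : FundamentalGroup (fieldPoint k K) | act α (extPoint E) = extPoint E} := by
    have := (continuous_app (fieldPoint k K).fiberFunctor (extCover E)).isOpen_preimage
      {τ | τ.hom (extPoint E) = extPoint E} (isOpen_discrete _)
    exact this
  rw [Filter.mem_map]
  refine Filter.mem_of_superset (h1.mem_nhds ?_) fun α hα => hEU ?_
  · rfl
  · obtain ⟨σ, rfl⟩ := e.surjective α
    rw [MulEquiv.symm_apply_apply]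
    have h2 : (galoisAct σ (extPoint E)).pt = (extPoint E).pt := congrArg _ hα
    have h3 := Spec.map_injective ((Spec.map_comp _ _).trans h2)
    intro x
    exact congrArg (fun g => g.hom x) h3

variable (k K) in
/-- The natural isomorphism of topological groups `π₁(Spec k, Spec K) ≃ Gal(K/k)`, the right hand
side carrying the Krull topology. -/
def galoisIso : FundamentalGroup (fieldPoint k K) ≃ₜ* Gal(K/k) where
  toMulEquiv := (MulEquiv.ofBijective (galoisToAut k K)
    ⟨galoisToAut_injective, galoisToAut_surjective⟩).symm
  continuous_toFun := continuous_galoisToAut_symm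
  continuous_invFun := by
    have : Algebra.IsAlgebraic k K := IsAlgClosure.isAlgebraic
    exact Continuous.continuous_symm_of_equiv_compact_to_t2
      (f := (MulEquiv.ofBijective (galoisToAut k K)
        ⟨galoisToAut_injective, galoisToAut_surjective⟩).symm.toEquiv)
      continuous_galoisToAut_symm

end Galois

end EtaleFundamental

namespace VirtualVar

open EtaleFundamental

/-- A scheme is normal if all its local rings are integrally closed domains. -/
def IsNormalScheme (X : Scheme.{u}) : Prop :=
  ∀ p : X, IsDomain (X.presheaf.stalk p) ∧ IsIntegrallyClosed (X.presheaf.stalk p)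

/-- The data `(X, Y, f, k, k̄, t)` of a virtual variety, without the section, together with a base
point `x` of `X`, so that `Π_X = π₁(X, x)`. The structure morphism of the `k`-scheme `X` is
`f ≫ t`, so that `f` is a `k`-morphism. Surjectivity of `f_*` and `t_*` does not depend on the
choice of base points and paths; it is stated for the base points `x`, `f ∘ x`, `t ∘ f ∘ x`. -/
structure Family (k kbar : Type u) [Field k] [CharZero k] [Field kbar] [Algebra k kbar]
    [IsAlgClosure k kbar] where
  X : Scheme.{u}
  Y : Scheme.{u}
  f : X ⟶ Y
  t : Y ⟶ Spec (.of k)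
  connected_X : ConnectedSpace X
  connected_Y : ConnectedSpace Y
  separated_X : IsSeparated (f ≫ t)
  separated_Y : IsSeparated t
  normal_X : IsNormalScheme X
  normal_Y : IsNormalScheme Y
  locallyOfFiniteType_X : LocallyOfFiniteType (f ≫ t)
  locallyOfFiniteType_Y : LocallyOfFiniteType t
  quasiCompact_X : QuasiCompact (f ≫ t)
  quasiCompact_Y : QuasiCompact t
  smooth_f : Smooth f
  x : GeometricPoint X
  surjective_f : Function.Surjective (pushforward f x)
  surjective_t : Function.Surjective (pushforward t (x.map f))

section

variable {k kbar : Type u} [Field k] [CharZero k] [Field kbar] [Algebra k kbar]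
  [IsAlgClosure k kbar]

namespace Family

variable (D : Family k kbar)

/-- The homomorphism `f_* : π₁(X, x) → π₁(Y, y)`. As the path from `f ∘ x` to `y` varies, this runs
through all representatives of the outer homomorphism induced by `f`. -/
def fStar {y : GeometricPoint D.Y} (γ : Path (D.x.map D.f) y) :
    FundamentalGroup D.x →ₜ* FundamentalGroup y :=
  (transport γ).comp (pushforward D.f D.x)

/-- The homomorphism `t_* : π₁(Y, y) → Gal(k̄/k)`. As the path from `t ∘ y` to the geometric point
`Spec k̄` of `Spec k` varies, this runs through all representatives of the outer homomorphism
induced by `t`. -/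
def tStar {y : GeometricPoint D.Y} (γ : Path (y.map D.t) (fieldPoint k kbar)) :
    FundamentalGroup y →ₜ* Gal(kbar/k) :=
  (galoisIso k kbar : FundamentalGroup (fieldPoint k kbar) →ₜ* Gal(kbar/k)).comp
    ((transport γ).comp (pushforward D.t y))

end Family

/-- A virtual variety `(X, Y, f, k, k̄, t, s)` over the given data `(X, Y, f, k, k̄, t)`: a base point
of `Y`, paths that fix representatives of the outer homomorphisms `f_*` and `t_*`, and a continuous
section `s` of `t_*`. -/
structure VirtualVariety (D : Family k kbar) where
  y : GeometricPoint D.Y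
  pathY : Path (D.x.map D.f) y
  pathK : Path (y.map D.t) (fieldPoint k kbar)
  s : Gal(kbar/k) →ₜ* FundamentalGroup y
  section_s : ∀ σ, D.tStar pathK (s σ) = σ

namespace VirtualVariety

variable {D : Family k kbar} (C : VirtualVariety D)

/-- The surjection `f_* : Π_X → Π_Y`. -/
def fStar : FundamentalGroup D.x →ₜ* FundamentalGroup C.y := D.fStar C.pathY

/-- The virtual fundamental group `Π_C`: the fibre product of `f_* : Π_X → Π_Y` and
`s : Gal(k̄/k) → Π_Y`, with the subspace topology from `Π_X × Gal(k̄/k)`. -/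
def virtualPi : Subgroup (FundamentalGroup D.x × Gal(kbar/k)) where
  carrier := {g | C.fStar g.1 = C.s g.2}
  mul_mem' {a b} ha hb := by
    simp only [Set.mem_ofPred_eq, Prod.fst_mul, Prod.snd_mul, map_mul] at ha hb ⊢
    rw [ha, hb]
  one_mem' := by simp
  inv_mem' {a} ha := by
    simp only [Set.mem_ofPred_eq, Prod.fst_inv, Prod.snd_inv, map_inv] at ha ⊢
    rw [ha]

/-- The projection `Π_C → Gal(k̄/k)`. -/
def toGal : C.virtualPi →ₜ* Gal(kbar/k) where
  toMonoidHom := (MonoidHom.snd _ _).comp C.virtualPi.subtype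
  continuous_toFun := continuous_snd.comp continuous_subtype_val

/-- The projection `Π_C → Π_X`. -/
def toPiX : C.virtualPi →ₜ* FundamentalGroup D.x where
  toMonoidHom := (MonoidHom.fst _ _).comp C.virtualPi.subtype
  continuous_toFun := continuous_fst.comp continuous_subtype_val

/-- The geometric virtual fundamental group `Δ_C`: the kernel of `Π_C → Gal(k̄/k)`. -/
def virtualDelta : Subgroup C.virtualPi := C.toGal.toMonoidHom.ker

/-- The inclusion `Δ_C → Π_C`. -/
def deltaToPi : C.virtualDelta →ₜ* C.virtualPi where
  toMonoidHom := C.virtualDelta.subtype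
  continuous_toFun := continuous_subtype_val

/-- The natural map `Δ_C → Π_C → Π_X`. -/
def deltaToPiX : C.virtualDelta →ₜ* FundamentalGroup D.x :=
  C.toPiX.comp C.deltaToPi

end VirtualVariety

end

/-- `1 → A → B → C → 1` is an exact sequence of topological groups: `i` is injective with image the
kernel of `p`, and `p` is surjective, where moreover `i` is a homeomorphism onto a closed subgroup
and `p` identifies `C` with the topological quotient group. -/
structure IsShortExact {A B C : Type*} [Group A] [TopologicalSpace A] [Group B]
    [TopologicalSpace B] [Group C] [TopologicalSpace C] (i : A →ₜ* B) (p : B →ₜ* C) : Prop where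
  injective : Function.Injective i
  exact : i.toMonoidHom.range = p.toMonoidHom.ker
  surjective : Function.Surjective p
  isClosedEmbedding : Topology.IsClosedEmbedding i
  isOpenQuotientMap : IsOpenQuotientMap p

end VirtualVar

end

/-!
Since `s` is a homomorphism, an element `(a, 1)` of `Π_C` is the same as an element `a` of `Π_X`
with `f_* a = s 1 = 1`, so the projection to `Π_X` identifies `Δ_C` with the kernel of `f_*`. Change
of base point along a path is injective, so this kernel is also that of `π₁(X, x) → π₁(Y, f ∘ x)`,
which involves neither the section nor the choices made on `Y` and `Spec k`. Surjectivity of `f_*`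
lifts `s σ` to `Π_X` and so makes `Π_C → Gal(k̄/k)` surjective. The topological parts of exactness
are automatic, as all groups here are compact and Hausdorff (`isShortExact_of_compact`).
-/

namespace EtaleFundamental

lemma transport_bijective {X : Scheme.{u}} {x x' : GeometricPoint X} (γ : Path x x') :
    Function.Bijective (transport γ) :=
  γ.conjAut.bijective

end EtaleFundamental

namespace VirtualVar

open EtaleFundamental

/-- Between compact Hausdorff groups, algebraic exactness of continuous homomorphisms suffices:
continuous injections are closed embeddings, and continuous surjections are closed maps, hence
quotient maps, hence open because they are homomorphisms. -/
lemma isShortExact_of_compact {A B C : Type*} [Group A] [TopologicalSpace A] [CompactSpace A]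
    [Group B] [TopologicalSpace B] [IsTopologicalGroup B] [CompactSpace B] [T2Space B]
    [Group C] [TopologicalSpace C] [T2Space C] {i : A →ₜ* B} {p : B →ₜ* C}
    (hi : Function.Injective i) (hip : i.toMonoidHom.range = p.toMonoidHom.ker)
    (hp : Function.Surjective p) : IsShortExact i p where
  injective := hi
  exact := hip
  surjective := hp
  isClosedEmbedding := i.continuous_toFun.isClosedEmbedding hi
  isOpenQuotientMap := MonoidHom.isOpenQuotientMap_of_isQuotientMap (φ := p)
    (p.continuous_toFun.isClosedMap.isQuotientMap p.continuous_toFun hp)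

variable {k kbar : Type u} [Field k] [CharZero k] [Field kbar] [Algebra k kbar]
  [IsAlgClosure k kbar]

namespace VirtualVariety

variable {D : Family k kbar} (C : VirtualVariety D)

lemma fStar_surjective : Function.Surjective C.fStar :=
  (transport_bijective C.pathY).2.comp D.surjective_f

lemma toGal_surjective : Function.Surjective C.toGal := fun σ => by
  obtain ⟨a, ha⟩ := C.fStar_surjective (C.s σ)
  exact ⟨⟨(a, σ), ha⟩, rfl⟩

lemma deltaToPiX_injective : Function.Injective C.deltaToPiX := fun g h hgh =>
  Subtype.ext (Subtype.ext (Prod.ext hgh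
    ((show g.1.1.2 = 1 from g.2).trans (show h.1.1.2 = 1 from h.2).symm)))

lemma range_deltaToPiX : C.deltaToPiX.toMonoidHom.range = C.fStar.toMonoidHom.ker := by
  ext a
  constructor
  · rintro ⟨g, rfl⟩
    have hg : g.1.1.2 = 1 := g.2
    have h : C.fStar g.1.1.1 = C.s g.1.1.2 := g.1.2
    rw [hg, map_one] at h
    exact h
  · intro ha
    exact ⟨⟨⟨(a, 1), (show C.fStar a = 1 from ha).trans (map_one C.s).symm⟩, rfl⟩, rfl⟩

/-- The kernel of `f_*` does not depend on the base point of `Y` or on the path to it. -/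
lemma ker_fStar : C.fStar.toMonoidHom.ker = (pushforward D.f D.x).toMonoidHom.ker := by
  ext a
  exact map_eq_one_iff (transport C.pathY) (transport_bijective C.pathY).1

lemma isClosed_virtualPi : IsClosed (C.virtualPi : Set (FundamentalGroup D.x × Gal(kbar/k))) :=
  isClosed_eq (C.fStar.continuous_toFun.comp continuous_fst)
    (C.s.continuous_toFun.comp continuous_snd)

instance : CompactSpace C.virtualPi :=
  have : Algebra.IsAlgebraic k kbar := IsAlgClosure.isAlgebraic
  isCompact_iff_compactSpace.mp C.isClosed_virtualPi.isCompact

instance : CompactSpace C.virtualDelta :=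
  have : Algebra.IsAlgebraic k kbar := IsAlgClosure.isAlgebraic
  isCompact_iff_compactSpace.mp (isClosed_singleton.preimage C.toGal.continuous_toFun).isCompact

end VirtualVariety

end VirtualVar

theorem corollary3p2 {k kbar : Type u} [Field k] [CharZero k] [Field kbar] [Algebra k kbar]
    [IsAlgClosure k kbar] (D : VirtualVar.Family k kbar) (C : VirtualVar.VirtualVariety D) :
    VirtualVar.IsShortExact C.deltaToPi C.toGal ∧
    VirtualVar.IsShortExact C.deltaToPiX C.fStar ∧
    ∀ C' : VirtualVar.VirtualVariety D,
      C'.deltaToPiX.toMonoidHom.range = C.deltaToPiX.toMonoidHom.range := by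
  have : Algebra.IsAlgebraic k kbar := IsAlgClosure.isAlgebraic
  refine ⟨VirtualVar.isShortExact_of_compact Subtype.val_injective (Subgroup.range_subtype _)
    C.toGal_surjective, VirtualVar.isShortExact_of_compact C.deltaToPiX_injective
    C.range_deltaToPiX C.fStar_surjective, fun C' => ?_⟩
  rw [C'.range_deltaToPiX, C.range_deltaToPiX, C'.ker_fStar, C.ker_fStar]
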